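/- Let $k\ge 5$ be an integer and let $h_k\in\mathbf R[x,y]$ be a non-zero homogeneous polynomial of degree $k$ that is harmonic, i.e. $\Delta h_k=0$ on $\mathbf R^2$, where $\Delta=\frac{\partial^2}{\partial x^2}+\frac{\partial^2}{\partial y^2}$. Let $R\colon(\mathbf R^2,\mathbf 0)\to\mathbf R$ be a $C^\infty$ function-germ at the origin of order greater than $k$ (all partial derivatives of $R$ of order $0,1,\dots,k$ vanish at $\mathbf 0$) such that $\Delta^2R=\Delta(\Delta R)=0$ in a neighbourhood of $\mathbf 0$. Then the germs at $\mathbf 0$ of $h_k$ and $h_k+R$ are right-equivalent: there is a germ of a $C^\infty$ diffeomorphism $\phi\colon(\mathbf R^2,\mathbf 0)\to(\mathbf R^2,\mathbf 0)$ with $h_k\circ\phi=h_k+R$ as germs at $\mathbf 0$. -/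

import Mathlib

open scoped ContDiff Topology

section GermsAtZero

variable {E F : Type*} [NormedAddCommGroup E] [NormedSpace ℝ E]
  [NormedAddCommGroup F] [NormedSpace ℝ F]

/-! A germ at `0` is given by a representative `f : E → F`. Every notion below depends only on the
values of `f` near `0`. -/

/-- `f` represents a `C^∞` germ at `0`: it is `C^∞` on a neighbourhood of `0` (the same
neighbourhood for derivatives of all orders). -/
def IsSmoothGerm (f : E → F) : Prop :=
  ∃ U : Set E, IsOpen U ∧ (0 : E) ∈ U ∧ ContDiffOn ℝ ∞ f U

/-- The germ of `f` at `0` has order more than `k`: all derivatives of `f` at `0` of order at most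
`k`, including the value `f 0`, vanish. (Meant for smooth germs.) -/
def HasOrderGT (f : E → F) (k : ℕ) : Prop :=
  ∀ j : ℕ, j ≤ k → iteratedFDeriv ℝ j f 0 = 0

/-- `φ` represents a diffeomorphism-germ `(E, 0) → (E, 0)`: it is a homeomorphism from an open
neighbourhood of `0` onto an open set, it fixes `0`, and it and its inverse are `C^∞`. -/
def IsDiffeoGerm (φ : OpenPartialHomeomorph E E) : Prop :=
  (0 : E) ∈ φ.source ∧ φ 0 = 0 ∧
    ContDiffOn ℝ ∞ φ φ.source ∧ ContDiffOn ℝ ∞ φ.symm φ.target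

/-- Right equivalence of germs at `0`: `f ∘ φ = g` as germs, for some diffeomorphism-germ `φ`. -/
def RightEquivalent (f g : E → F) : Prop :=
  ∃ φ : OpenPartialHomeomorph E E, IsDiffeoGerm φ ∧ f ∘ φ =ᶠ[𝓝 0] g

end GermsAtZero

/-- The function on the Euclidean plane defined by a real polynomial in two variables. -/
noncomputable def polyFun (p : MvPolynomial (Fin 2) ℝ) : EuclideanSpace ℝ (Fin 2) → ℝ :=
  fun x => MvPolynomial.eval (fun i => x i) p

/-!
Identify the plane with `ℂ` by an isometry, under which the Laplacian is unchanged. A harmonic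
homogeneous polynomial of degree `k ≥ 1` is then `h z = Re (c * z ^ k)`, with `c ≠ 0` if `h ≠ 0`
(`exists_eq_re_const_mul_pow`). By Almansi's decomposition a biharmonic germ is
`R z = Re (F z + conj z * G z)` with `F` and `G` holomorphic: as `Δ R` is the real part of a
holomorphic function and `Δ (Re (conj z * G)) = 4 Re G'`, a primitive `G` makes
`R - Re (conj z * G)` harmonic.

The order condition on `R` passes to `G` and `F`. A holomorphic germ whose real part is
`o(|z| ^ n)` and whose value at `0` is real is divisible by `z ^ (n + 1)`
(`exists_eq_pow_mul_of_re_isLittleO`), because its leading term takes nonzero real values in some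
direction. Since `R = o(|z| ^ k)` and `Δ R = o(|z| ^ (k - 2))`, the holomorphic function with real
part `Δ R` is divisible by `z ^ (k - 1)`, hence `G` by `z ^ k`, and then `F` by `z ^ (k + 1)`
(`exists_almansi_of_hasOrderGT`). Therefore

  `h z + R z = Re (z ^ k * (c + v z))`,  `v z = z * f z + conj z * g z`,

with `v` real-analytic and `v 0 = 0`. This is `h (Ψ z)` for `Ψ z = z * (1 + v z / c) ^ (1 / k)`
(`exists_const_mul_pow_eq`), a real-analytic map with `Ψ 0 = 0` and derivative the identity at `0`,
which the inverse function theorem turns into a diffeomorphism germ (`exists_isDiffeoGerm_eq`).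
-/

open Asymptotics Filter

/-! ### Order of vanishing of smooth germs -/

theorem isLittleO_norm_pow_succ_of_fderiv {E F : Type*} [NormedAddCommGroup E] [NormedSpace ℝ E]
    [NormedAddCommGroup F] [NormedSpace ℝ F] {f : E → F} {n : ℕ}
    (hf : ∀ᶠ x in 𝓝 (0 : E), DifferentiableAt ℝ f x) (h0 : f 0 = 0)
    (hd : fderiv ℝ f =o[𝓝 0] fun x ↦ ‖x‖ ^ n) : f =o[𝓝 0] fun x ↦ ‖x‖ ^ (n + 1) := by
  rw [isLittleO_iff]
  intro c hc
  obtain ⟨ε, hε, hball⟩ := Metric.eventually_nhds_iff_ball.1 (hf.and (hd.bound hc))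
  refine Metric.eventually_nhds_iff_ball.2 ⟨ε, hε, fun x hx ↦ ?_⟩
  have hsub : Metric.closedBall (0 : E) ‖x‖ ⊆ Metric.ball 0 ε :=
    Metric.closedBall_subset_ball (by simpa using hx)
  have key := (convex_closedBall (0 : E) ‖x‖).norm_image_sub_le_of_norm_fderiv_le (𝕜 := ℝ)
    (f := f) (C := c * ‖x‖ ^ n) (x := 0) (y := x) (fun y hy ↦ (hball y (hsub hy)).1)
    (fun y hy ↦ ?_) (by simp) (by simp)
  · rw [h0, sub_zero, sub_zero] at key
    rw [norm_pow, norm_norm, pow_succ, ← mul_assoc]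
    exact key
  · refine (hball y (hsub hy)).2.trans ?_
    have : ‖y‖ ≤ ‖x‖ := by simpa using hy
    rw [norm_pow, norm_norm]
    gcongr

theorem IsSmoothGerm.eventually_contDiffAt {E F : Type*} [NormedAddCommGroup E] [NormedSpace ℝ E]
    [NormedAddCommGroup F] [NormedSpace ℝ F] {f : E → F} (hf : IsSmoothGerm f) :
    ∀ᶠ x in 𝓝 (0 : E), ContDiffAt ℝ ∞ f x := by
  obtain ⟨U, hU, h0, hfU⟩ := hf
  filter_upwards [hU.mem_nhds h0] with x hx
  exact hfU.contDiffAt (hU.mem_nhds hx)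

/-- Peano form of Taylor's theorem for a germ whose derivatives of order at most `k` vanish. -/
theorem HasOrderGT.iteratedFDeriv_isLittleO {E F : Type*} [NormedAddCommGroup E] [NormedSpace ℝ E]
    [NormedAddCommGroup F] [NormedSpace ℝ F] {f : E → F} {j k n : ℕ} (hk : HasOrderGT f k)
    (hf : ∀ᶠ x in 𝓝 (0 : E), ContDiffAt ℝ ∞ f x) (hjn : j + n = k) :
    iteratedFDeriv ℝ j f =o[𝓝 0] fun x ↦ ‖x‖ ^ n := by
  induction n generalizing j with
  | zero =>
    simp only [pow_zero]
    refine (isLittleO_one_iff ℝ).2 ?_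
    have := (hf.self_of_nhds.differentiableAt_iteratedFDeriv (m := j)
      (by exact_mod_cast ENat.natCast_lt_top j)).continuousAt.tendsto
    rwa [hk j (by lia)] at this
  | succ n ih =>
    refine isLittleO_norm_pow_succ_of_fderiv ?_ (hk j (by lia)) ?_
    · filter_upwards [hf] with x hx
      exact hx.differentiableAt_iteratedFDeriv (by exact_mod_cast ENat.natCast_lt_top j)
    · refine (isLittleO_norm_left.1 ?_)
      simp only [norm_fderiv_iteratedFDeriv]
      exact (ih (j := j + 1) (by lia)).norm_left

/-! ### The Laplacian -/

theorem laplacian_comp_linearIsometryEquiv {E E' F : Type*} [NormedAddCommGroup E]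
    [InnerProductSpace ℝ E] [FiniteDimensional ℝ E] [NormedAddCommGroup E'] [InnerProductSpace ℝ E']
    [FiniteDimensional ℝ E'] [NormedAddCommGroup F] [NormedSpace ℝ F] (e : E ≃ₗᵢ[ℝ] E')
    (f : E' → F) : Laplacian.laplacian (f ∘ e) = Laplacian.laplacian f ∘ e := by
  ext x
  rw [InnerProductSpace.laplacian_eq_iteratedFDeriv_orthonormalBasis _ (stdOrthonormalBasis ℝ E),
    InnerProductSpace.laplacian_eq_iteratedFDeriv_orthonormalBasis _
      ((stdOrthonormalBasis ℝ E).map e)]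
  have h (x : E) : iteratedFDeriv ℝ 2 (f ∘ e) x =
      (iteratedFDeriv ℝ 2 f (e x)).compContinuousLinearMap
        fun _ ↦ (e.toContinuousLinearEquiv : E →L[ℝ] E') := by
    have := e.toContinuousLinearEquiv.iteratedFDerivWithin_comp_right f uniqueDiffOn_univ
      (x := x) (Set.mem_univ _) 2
    simpa [iteratedFDerivWithin_univ] using this
  simp only [h, Function.comp_apply]
  refine Finset.sum_congr rfl fun i _ ↦ ?_
  rw [ContinuousMultilinearMap.compContinuousLinearMap_apply]
  congr 1
  ext j
  fin_cases j <;> simp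

theorem laplacian_isLittleO {E F : Type*} [NormedAddCommGroup E]
    [InnerProductSpace ℝ E] [FiniteDimensional ℝ E] [NormedAddCommGroup F] [NormedSpace ℝ F]
    {f : E → F} {g : E → ℝ} {l : Filter E} (h : iteratedFDeriv ℝ 2 f =o[l] g) :
    Laplacian.laplacian f =o[l] g := by
  rw [InnerProductSpace.laplacian_eq_iteratedFDeriv_stdOrthonormalBasis]
  refine IsLittleO.fun_sum fun i _ ↦ ?_
  refine IsBigO.trans_isLittleO (g := iteratedFDeriv ℝ 2 f) ?_ h
  refine IsBigO.of_bound 1 (Eventually.of_forall fun x ↦ ?_)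
  refine (ContinuousMultilinearMap.le_opNorm _ _).trans ?_
  rw [Fin.prod_univ_two]
  simp

theorem ContDiffAt.laplacian_right {E F : Type*} [NormedAddCommGroup E]
    [InnerProductSpace ℝ E] [FiniteDimensional ℝ E] [NormedAddCommGroup F] [NormedSpace ℝ F]
    {f : E → F} {x : E} {m n : ℕ∞ω} (hf : ContDiffAt ℝ n f x) (hmn : m + 2 ≤ n) :
    ContDiffAt ℝ m (Laplacian.laplacian f) x := by
  rw [InnerProductSpace.laplacian_eq_iteratedFDeriv_stdOrthonormalBasis]
  have h := hf.iteratedFDeriv_right (i := 2) hmn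
  exact ContDiffAt.sum fun i _ ↦
    (ContinuousMultilinearMap.apply ℝ (fun _ : Fin 2 ↦ E) F
      ![stdOrthonormalBasis ℝ E i, stdOrthonormalBasis ℝ E i]).contDiff.contDiffAt.comp x h

/-- The computation behind Almansi's decomposition: the second derivative of `conj z * G z` in
the direction `v` is `2 |v|² G' + conj z * v² G''`, and the terms with `v² = 1` and `v² = I²`
cancel. -/
theorem laplacian_re_conj_mul {G : ℂ → ℂ} {z : ℂ} (hG : AnalyticAt ℂ G z) :
    Laplacian.laplacian (fun z ↦ (starRingEnd ℂ z * G z).re) z = 4 * (deriv G z).re := by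
  have hder : ∀ᶠ y in 𝓝 z, HasFDerivAt (𝕜 := ℝ) (fun z ↦ starRingEnd ℂ z * G z)
      (starRingEnd ℂ y • ((ContinuousLinearMap.toSpanSingleton ℂ (deriv G y)).restrictScalars ℝ)
        + G y • (Complex.conjCLE : ℂ →L[ℝ] ℂ)) y := by
    filter_upwards [hG.eventually_analyticAt] with y hy
    have h1 : HasFDerivAt (𝕜 := ℝ) (fun z ↦ starRingEnd ℂ z) (Complex.conjCLE : ℂ →L[ℝ] ℂ) y :=
      Complex.conjCLE.hasFDerivAt
    exact h1.mul (hy.differentiableAt.hasDerivAt.hasFDerivAt.restrictScalars ℝ)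
  have hcd : ContDiffAt ℝ ω (fun z ↦ starRingEnd ℂ z * G z) z :=
    (Complex.conjCLE.contDiff.contDiffAt).mul (hG.contDiffAt.restrict_scalars ℝ)
  have h2 (v : ℂ) : iteratedFDeriv ℝ 2 (fun z ↦ starRingEnd ℂ z * G z) z ![v, v] =
      2 * (starRingEnd ℂ v * v * deriv G z) + starRingEnd ℂ z * v ^ 2 * deriv (deriv G) z := by
    have hd : DifferentiableAt ℝ (fderiv ℝ fun z ↦ starRingEnd ℂ z * G z) z :=
      (hcd.fderiv_right (m := 1) (by exact le_top)).differentiableAt one_ne_zero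
    have h3 : fderiv ℝ (fderiv ℝ fun z ↦ starRingEnd ℂ z * G z) z v v =
        fderiv ℝ (fun y ↦ fderiv ℝ (fun z ↦ starRingEnd ℂ z * G z) y v) z v := by
      rw [fderiv_clm_apply hd (differentiableAt_const v)]
      simp
    have h4 : (fun y ↦ fderiv ℝ (fun z ↦ starRingEnd ℂ z * G z) y v) =ᶠ[𝓝 z]
        fun y ↦ starRingEnd ℂ y * (v * deriv G y) + G y * starRingEnd ℂ v := by
      filter_upwards [hder] with y hy
      simp [hy.fderiv]
    have h5 : HasFDerivAt (𝕜 := ℝ)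
        (fun y ↦ starRingEnd ℂ y * (v * deriv G y) + G y * starRingEnd ℂ v) _ z :=
      ((Complex.conjCLE.hasFDerivAt (x := z)).mul
        ((hG.deriv.differentiableAt.hasDerivAt.hasFDerivAt.restrictScalars ℝ).const_mul v)).add
      ((hG.differentiableAt.hasDerivAt.hasFDerivAt.restrictScalars ℝ).mul_const _)
    rw [iteratedFDeriv_two_apply]
    simp only [Matrix.cons_val_zero, Matrix.cons_val_one]
    rw [h3, h4.fderiv_eq, h5.fderiv]
    simp
    ring
  have hre := (hcd.of_le (m := 2) le_top).laplacian_CLM_comp_left (l := Complex.reCLM)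
  refine hre.trans ?_
  rw [Function.comp_apply, InnerProductSpace.laplacian_eq_iteratedFDeriv_complexPlane]
  simp only [h2, Complex.reCLM_apply]
  simp
  ring

/-! ### Harmonic and biharmonic germs in the complex plane -/

/-- A holomorphic germ `F` with `F 0` real is divisible by `z ^ (n + 1)` as soon as its real part
is `o(|z| ^ n)`: the leading term of `F` takes a nonzero real part in some direction. -/
theorem exists_eq_pow_mul_of_re_isLittleO {F : ℂ → ℂ} {n : ℕ} (hF : AnalyticAt ℂ F 0)
    (him : (F 0).im = 0) (hre : (fun z ↦ (F z).re) =o[𝓝 0] fun z : ℂ ↦ ‖z‖ ^ n) :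
    ∃ f : ℂ → ℂ, AnalyticAt ℂ f 0 ∧ ∀ᶠ z in 𝓝 0, F z = z ^ (n + 1) * f z := by
  suffices h : ((n + 1 : ℕ) : ℕ∞) ≤ analyticOrderAt F 0 by
    simpa using (natCast_le_analyticOrderAt hF).1 h
  by_contra! hlt
  obtain ⟨m, hm⟩ := ENat.ne_top_iff_exists.1 hlt.ne_top
  rw [← hm] at hlt
  have hmn : m ≤ n := by
    have : m < n + 1 := by exact_mod_cast hlt
    lia
  obtain ⟨g, hg, hg0, hFg⟩ := (hF.analyticOrderAt_eq_natCast).1 hm.symm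
  simp only [sub_zero, smul_eq_mul] at hFg
  -- a direction `w` in which the leading term `w ^ m * g 0` is real and nonzero
  obtain ⟨w, hw, hw'⟩ : ∃ w : ℂ, w ≠ 0 ∧ (w ^ m * g 0).re ≠ 0 := by
    rcases Nat.eq_zero_or_pos m with rfl | hm0
    · refine ⟨1, one_ne_zero, fun h ↦ hg0 ?_⟩
      have h0 := hFg.self_of_nhds
      simp only [pow_zero, one_mul] at h0 h
      exact Complex.ext h (by rw [← h0, him]; rfl)
    · obtain ⟨w, hw⟩ := IsAlgClosed.exists_pow_nat_eq (g 0)⁻¹ hm0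
      refine ⟨w, ?_, by simp [hw, hg0]⟩
      rintro rfl
      rw [zero_pow hm0.ne'] at hw
      exact inv_ne_zero hg0 hw.symm
  refine hw' (tendsto_nhds_unique (f := fun t : ℝ ↦ (w ^ m * g (t * w)).re)
    (l := 𝓝[>] 0) ?_ ?_)
  · have hc : ContinuousAt (fun t : ℝ ↦ (w ^ m * g (t * w)).re) 0 := by
      have : ContinuousAt g ((0 : ℝ) * w) := by simpa using hg.continuousAt
      have h2 : ContinuousAt (fun t : ℝ ↦ g (t * w)) 0 :=
        ContinuousAt.comp (f := fun t : ℝ ↦ (t : ℂ) * w) this (by fun_prop)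
      exact Complex.continuous_re.continuousAt.comp (continuousAt_const.mul h2)
    simpa using hc.tendsto.mono_left nhdsWithin_le_nhds
  · have ht : Tendsto (fun t : ℝ ↦ (t : ℂ) * w) (𝓝[>] 0) (𝓝 0) := by
      have : Tendsto (fun t : ℝ ↦ (t : ℂ) * w) (𝓝 0) (𝓝 ((0 : ℝ) * w)) :=
        Continuous.tendsto (by fun_prop) 0
      simpa using this.mono_left nhdsWithin_le_nhds
    have h1 : (fun t : ℝ ↦ (F (t * w)).re) =o[𝓝[>] 0] fun t : ℝ ↦ t ^ m := by
      refine (hre.comp_tendsto ht).trans_isBigO (IsBigO.of_bound (‖w‖ ^ n) ?_)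
      have : Set.Ioo (0 : ℝ) 1 ∈ 𝓝[>] 0 := Ioo_mem_nhdsGT one_pos
      filter_upwards [this] with t ht
      have : |t| ^ n ≤ |t| ^ m := pow_le_pow_of_le_one (abs_nonneg _)
        (by rw [abs_of_pos ht.1]; exact ht.2.le) hmn
      simp only [Function.comp_apply, norm_mul, Complex.norm_real, norm_pow, Real.norm_eq_abs,
        mul_pow, abs_norm, abs_abs]
      rw [mul_comm]
      gcongr
    refine h1.tendsto_div_nhds_zero.congr' ?_
    filter_upwards [ht.eventually hFg, self_mem_nhdsWithin] with t hFt ht0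
    have : (t : ℝ) ^ m ≠ 0 := pow_ne_zero _ (ne_of_gt ht0)
    rw [hFt, mul_pow, mul_assoc, ← Complex.ofReal_pow, Complex.re_ofReal_mul]
    field_simp

theorem exists_analyticAt_deriv_eventuallyEq {W : ℂ → ℂ} (hW : AnalyticAt ℂ W 0) :
    ∃ G : ℂ → ℂ, AnalyticAt ℂ G 0 ∧ G 0 = 0 ∧ deriv G =ᶠ[𝓝 0] W := by
  obtain ⟨r, hr, hball⟩ := Metric.eventually_nhds_iff_ball.1 hW.eventually_analyticAt
  obtain ⟨G, hG0, hG⟩ := DifferentiableOn.isExactOn_ball (c := 0) (r := r) (f := W)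
    (fun z hz ↦ (hball z hz).differentiableAt.differentiableWithinAt) |>.with_val_at 0 0
  have hmem : Metric.ball (0 : ℂ) r ∈ 𝓝 0 := Metric.ball_mem_nhds 0 hr
  refine ⟨G, DifferentiableOn.analyticAt (s := Metric.ball 0 r)
    (fun z hz ↦ (hG z hz).differentiableAt.differentiableWithinAt) hmem, hG0, ?_⟩
  filter_upwards [hmem] with z hz using (hG z hz).deriv

/-- A harmonic germ that is `o(|z| ^ n)` is the real part of a holomorphic germ divisible by
`z ^ (n + 1)`. -/
theorem InnerProductSpace.HarmonicAt.exists_eq_re_pow_mul {f : ℂ → ℝ} {n : ℕ}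
    (hf : InnerProductSpace.HarmonicAt f 0) (ho : f =o[𝓝 0] fun z : ℂ ↦ ‖z‖ ^ n) :
    ∃ g : ℂ → ℂ, AnalyticAt ℂ g 0 ∧ ∀ᶠ z in 𝓝 0, f z = (z ^ (n + 1) * g z).re := by
  obtain ⟨r, hr, hball⟩ := Metric.eventually_nhds_iff_ball.1 hf.eventually
  obtain ⟨F, hF, hFf⟩ :=
    InnerProductSpace.HarmonicOnNhd.exists_analyticOnNhd_ball_re_eq (f := f) (z := 0) (R := r) hball
  have hmem : Metric.ball (0 : ℂ) r ∈ 𝓝 0 := Metric.ball_mem_nhds 0 hr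
  -- subtracting `i * Im (F 0)` makes the value at `0` real without changing the real part
  have hre : (fun z ↦ (F z - (F 0).im * Complex.I).re) =ᶠ[𝓝 0] f := by
    filter_upwards [hmem] with z hz
    simpa using hFf hz
  obtain ⟨g, hg, hFg⟩ := exists_eq_pow_mul_of_re_isLittleO
    (F := fun z ↦ F z - (F 0).im * Complex.I) (n := n)
    ((hF 0 (Metric.mem_ball_self hr)).sub analyticAt_const) (by simp) (hre.trans_isLittleO ho)
  refine ⟨g, hg, ?_⟩
  filter_upwards [hre, hFg] with z h1 h2
  rw [← h1, h2]

/-- Almansi's decomposition of a biharmonic germ of order greater than `k`: it is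
`Re (F z + conj z * G z)` with `F = z ^ (k + 1) * f` and `G = z ^ k * g` holomorphic. -/
theorem exists_almansi_of_hasOrderGT {R : ℂ → ℝ} {k : ℕ} (hk : 2 ≤ k)
    (hR : ∀ᶠ z in 𝓝 0, ContDiffAt ℝ ∞ R z) (hord : HasOrderGT R k)
    (hΔ : ∀ᶠ z in 𝓝 (0 : ℂ), Laplacian.laplacian (Laplacian.laplacian R) z = 0) :
    ∃ f g : ℂ → ℂ, AnalyticAt ℂ f 0 ∧ AnalyticAt ℂ g 0 ∧
      ∀ᶠ z in 𝓝 0, R z = (z ^ k * (z * f z + starRingEnd ℂ z * g z)).re := by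
  obtain ⟨m, rfl⟩ := Nat.exists_eq_add_of_le hk
  have hharm : InnerProductSpace.HarmonicAt (Laplacian.laplacian R) 0 :=
    ⟨hR.self_of_nhds.laplacian_right (m := 2)
      (WithTop.coe_le_coe.2 (le_top : ((2 + 2 : ℕ∞)) ≤ ⊤)), hΔ⟩
  obtain ⟨w, hw, hRw⟩ := hharm.exists_eq_re_pow_mul (n := m)
    (laplacian_isLittleO (hord.iteratedFDeriv_isLittleO hR rfl))
  obtain ⟨G, hG, hG0, hGd⟩ := exists_analyticAt_deriv_eventuallyEq
    (W := fun z ↦ z ^ (m + 1) * (w z / 4)) (by fun_prop)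
  obtain ⟨g, hg, hGg⟩ : ∃ g : ℂ → ℂ, AnalyticAt ℂ g 0 ∧ ∀ᶠ z in 𝓝 0, G z = z ^ (2 + m) * g z := by
    have h1 : ((m + 1 : ℕ) : ℕ∞) ≤ analyticOrderAt (deriv G) 0 :=
      (natCast_le_analyticOrderAt hG.deriv).2 ⟨fun z ↦ w z / 4, by fun_prop, by
        filter_upwards [hGd] with z hz
        simpa using hz⟩
    rw [analyticOrderAt_deriv_ge_iff hG hG0] at h1
    have h2 : ((2 + m : ℕ) : ℕ∞) ≤ analyticOrderAt G 0 := by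
      convert h1 using 1
      push_cast
      ring
    simpa using (natCast_le_analyticOrderAt hG).1 h2
  have hcd : ∀ᶠ z in 𝓝 0, ContDiffAt ℝ 2 (fun z ↦ (starRingEnd ℂ z * G z).re) z := by
    filter_upwards [hG.eventually_analyticAt] with z hz
    exact Complex.reCLM.contDiff.contDiffAt.comp z
      (Complex.conjCLE.contDiff.contDiffAt.mul (hz.contDiffAt.restrict_scalars ℝ))
  have hR2 : ∀ᶠ z in 𝓝 0, ContDiffAt ℝ 2 R z :=
    hR.mono fun z hz ↦ hz.of_le (WithTop.coe_le_coe.2 (le_top : (2 : ℕ∞) ≤ ⊤))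
  have hharm' : InnerProductSpace.HarmonicAt (R - fun z ↦ (starRingEnd ℂ z * G z).re) 0 := by
    refine ⟨hR2.self_of_nhds.sub hcd.self_of_nhds, ?_⟩
    filter_upwards [hR2, hcd, hRw, hGd, hG.eventually_analyticAt] with z h1 h2 h3 h4 h5
    rw [h1.laplacian_sub h2, laplacian_re_conj_mul h5, h3, h4]
    have : (z ^ (m + 1) * w z) = (4 : ℝ) * (z ^ (m + 1) * (w z / 4)) := by push_cast; ring
    rw [this, Complex.re_ofReal_mul]
    simp
  have hRo : R =o[𝓝 0] fun z : ℂ ↦ ‖z‖ ^ (2 + m) := by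
    have := (hord.iteratedFDeriv_isLittleO hR (zero_add _)).norm_left
    simp only [norm_iteratedFDeriv_zero] at this
    exact this.of_norm_left
  have hGo : (fun z ↦ (starRingEnd ℂ z * G z).re) =o[𝓝 0] fun z : ℂ ↦ ‖z‖ ^ (2 + m) := by
    have h1 : (fun z ↦ (starRingEnd ℂ z * G z).re) =O[𝓝 0]
        fun z : ℂ ↦ (starRingEnd ℂ z * g z) * z ^ (2 + m) := by
      refine IsBigO.of_bound 1 ?_
      filter_upwards [hGg] with z hz
      rw [one_mul, Real.norm_eq_abs]
      refine (Complex.abs_re_le_norm _).trans (le_of_eq ?_)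
      rw [hz]
      ring_nf
    have h2 : (fun z : ℂ ↦ starRingEnd ℂ z * g z) =o[𝓝 0] fun _ ↦ (1 : ℝ) := by
      refine (isLittleO_one_iff ℝ).2 ?_
      have : ContinuousAt (fun z : ℂ ↦ starRingEnd ℂ z * g z) 0 :=
        Complex.continuous_conj.continuousAt.mul hg.continuousAt
      simpa using this.tendsto
    refine h1.trans_isLittleO ?_
    simpa using h2.mul_isBigO (IsBigO.of_norm_right
      (g' := fun z : ℂ ↦ ‖z‖ ^ (2 + m)) (f := fun z : ℂ ↦ z ^ (2 + m)) (by
        simpa using (isBigO_refl (fun z : ℂ ↦ z ^ (2 + m)) (𝓝 0)).norm_right))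
  obtain ⟨f, hf, hRf⟩ := hharm'.exists_eq_re_pow_mul (hRo.sub hGo)
  refine ⟨f, g, hf, hg, ?_⟩
  filter_upwards [hRf, hGg] with z h1 h2
  rw [Pi.sub_apply, sub_eq_iff_eq_add, h2] at h1
  rw [h1, ← Complex.add_re]
  ring_nf

/-! ### Homogeneous harmonic polynomials -/

/-- A harmonic function homogeneous of degree `k` is `Re (c * z ^ k)`. Homogeneity gives
`h = Re (z ^ k * g z)` near `0`, and then `h z = t⁻ᵏ * h (t * z) → Re (z ^ k * g 0)` as `t → 0⁺`. -/
theorem exists_eq_re_const_mul_pow {h : ℂ → ℝ} {k : ℕ} (hk : k ≠ 0)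
    (hcont : ContDiff ℝ 2 h) (hharm : ∀ z, Laplacian.laplacian h z = 0)
    (hhom : ∀ (t : ℝ) (z : ℂ), h (t * z) = t ^ k * h z) :
    ∃ c : ℂ, ∀ z, h z = (c * z ^ k).re := by
  obtain ⟨n, rfl⟩ := Nat.exists_eq_succ_of_ne_zero hk
  have hO : h =o[𝓝 0] fun z : ℂ ↦ ‖z‖ ^ n := by
    obtain ⟨C, hC⟩ := (isCompact_sphere (0 : ℂ) 1).exists_bound_of_continuousOn
      hcont.continuous.continuousOn
    have h1 : h =O[𝓝 0] fun z : ℂ ↦ ‖z‖ ^ (n + 1) := by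
      refine IsBigO.of_bound C (Eventually.of_forall fun z ↦ ?_)
      rcases eq_or_ne z 0 with rfl | hz
      · have := hhom 0 0
        simp at this
        simp [this]
      · have hz' : (‖z‖ : ℂ) ≠ 0 := by simpa using hz
        have h2 := hhom ‖z‖ (z / ‖z‖)
        rw [mul_div_cancel₀ _ hz'] at h2
        rw [h2, norm_mul, mul_comm]
        gcongr
        exact hC _ (by simp [hz])
    refine h1.trans_isLittleO ?_
    have h3 : (fun z : ℂ ↦ ‖z‖) =o[𝓝 0] fun _ ↦ (1 : ℝ) :=
      (isLittleO_one_iff ℝ).2 (by simpa using (continuous_norm (E := ℂ)).tendsto 0)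
    simpa [pow_succ] using (isBigO_refl (fun z : ℂ ↦ ‖z‖ ^ n) (𝓝 0)).mul_isLittleO h3
  obtain ⟨g, hg, hhg⟩ := InnerProductSpace.HarmonicAt.exists_eq_re_pow_mul
    ⟨hcont.contDiffAt, Eventually.of_forall hharm⟩ hO
  refine ⟨g 0, fun z ↦ ?_⟩
  have ht : Tendsto (fun t : ℝ ↦ (t : ℂ) * z) (𝓝[>] 0) (𝓝 0) := by
    have : Tendsto (fun t : ℝ ↦ (t : ℂ) * z) (𝓝 0) (𝓝 ((0 : ℝ) * z)) :=
      Continuous.tendsto (by fun_prop) 0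
    simpa using this.mono_left nhdsWithin_le_nhds
  have hlim : Tendsto (fun t : ℝ ↦ (z ^ (n + 1) * g (t * z)).re) (𝓝[>] 0)
      (𝓝 (z ^ (n + 1) * g 0).re) :=
    (Complex.continuous_re.tendsto _).comp
      (tendsto_const_nhds.mul (hg.continuousAt.tendsto.comp ht))
  rw [mul_comm]
  refine tendsto_nhds_unique (tendsto_const_nhds.congr' ?_) hlim
  filter_upwards [ht.eventually hhg, self_mem_nhdsWithin] with t hth ht0
  have : (t : ℝ) ^ (n + 1) ≠ 0 := pow_ne_zero _ (ne_of_gt ht0)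
  rw [hhom, mul_pow, mul_assoc, ← Complex.ofReal_pow, Complex.re_ofReal_mul] at hth
  exact mul_left_cancel₀ this hth

theorem contDiff_polyFun (p : MvPolynomial (Fin 2) ℝ) : ContDiff ℝ ω (polyFun p) := by
  have : polyFun p = fun x : EuclideanSpace ℝ (Fin 2) ↦
      ∑ d ∈ p.support, p.coeff d * ∏ i, x i ^ d i := by
    ext x
    exact MvPolynomial.eval_eq' _ _
  rw [this]
  fun_prop

theorem polyFun_smul {p : MvPolynomial (Fin 2) ℝ} {k : ℕ} (hp : p.IsHomogeneous k) (t : ℝ)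
    (x : EuclideanSpace ℝ (Fin 2)) : polyFun p (t • x) = t ^ k * polyFun p x := by
  simp only [polyFun, MvPolynomial.eval_eq', Finset.mul_sum]
  refine Finset.sum_congr rfl fun d hd ↦ ?_
  have hdk : ∑ i, d i = k := by
    rw [← hp (MvPolynomial.mem_support_iff.1 hd), Finsupp.weight_apply, Finsupp.sum_fintype] <;> simp
  simp only [PiLp.smul_apply, smul_eq_mul, mul_pow, Finset.prod_mul_distrib,
    Finset.prod_pow_eq_pow_sum, hdk]
  ring

/-! ### Construction of the diffeomorphism germ -/

/-- Inverse function theorem for germs. Real-analyticity at `0` is assumed, rather than smoothness,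
because it extends from the point to a neighbourhood. -/
theorem exists_isDiffeoGerm_eq {E : Type*} [NormedAddCommGroup E] [NormedSpace ℝ E]
    [CompleteSpace E] {Ψ : E → E} {L : E ≃L[ℝ] E} (hΨ : ContDiffAt ℝ ω Ψ 0) (h0 : Ψ 0 = 0)
    (hL : HasFDerivAt Ψ (L : E →L[ℝ] E) 0) :
    ∃ φ : OpenPartialHomeomorph E E, IsDiffeoGerm φ ∧ ⇑φ = Ψ := by
  have hev : ∀ᶠ x in 𝓝 (0 : E), ContDiffAt ℝ ω Ψ x ∧
      fderiv ℝ Ψ x ∈ Set.range ((↑) : (E ≃L[ℝ] E) → E →L[ℝ] E) := by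
    refine (hΨ.eventually (by simp)).and ?_
    refine (hΨ.continuousAt_fderiv (by simp)).eventually ?_
    rw [hL.fderiv]
    exact L.nhds
  obtain ⟨U, hU, hUo, h0U⟩ := eventually_nhds_iff.1 hev
  let φ := (hΨ.toOpenPartialHomeomorph Ψ hL (by simp)).restrOpen U hUo
  have hφ : ⇑φ = Ψ := rfl
  have hsrc : φ.source ⊆ U := fun x hx ↦ hx.2
  refine ⟨φ, ⟨⟨hΨ.mem_toOpenPartialHomeomorph_source hL (by simp), h0U⟩, h0, ?_, ?_⟩, hφ⟩
  · exact fun x hx ↦ ((hU x (hsrc hx)).1.of_le le_top).contDiffWithinAt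
  · intro y hy
    obtain ⟨hcd, L', hL'⟩ := hU _ (hsrc (φ.map_target hy))
    refine (φ.contDiffAt_symm hy (f₀' := L') ?_ (hcd.of_le le_top)).contDiffWithinAt
    rw [hL']
    exact (hcd.differentiableAt (by simp)).hasFDerivAt

/-- If `v 0 = 0` then `c * z ^ k`, perturbed to `z ^ k * (c + v z)`, is still `c` times a `k`-th
power, namely that of `z * (1 + v z / c) ^ (1 / k)`, which is tangent to the identity at `0`. -/
theorem exists_const_mul_pow_eq {k : ℕ} (hk : k ≠ 0) {c : ℂ} (hc : c ≠ 0) {v : ℂ → ℂ}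
    (hv : ContDiffAt ℝ ω v 0) (hv0 : v 0 = 0) :
    ∃ Ψ : ℂ → ℂ, ContDiffAt ℝ ω Ψ 0 ∧ Ψ 0 = 0 ∧ HasFDerivAt Ψ (ContinuousLinearMap.id ℝ ℂ) 0 ∧
      ∀ z, c * Ψ z ^ k = z ^ k * (c + v z) := by
  set u : ℂ → ℂ := fun z ↦ (1 + v z / c) ^ (1 / (k : ℂ)) with hu
  have hu_cd : ContDiffAt ℝ ω u 0 := by
    have h1 : AnalyticAt ℂ (fun w : ℂ ↦ (1 + w / c) ^ (1 / (k : ℂ))) (v 0) := by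
      rw [hv0]
      exact AnalyticAt.cpow (by fun_prop) analyticAt_const (by simp)
    exact (h1.contDiffAt.restrict_scalars ℝ).comp 0 hv
  have hu0 : u 0 = 1 := by simp [hu, hv0]
  refine ⟨fun z ↦ z * u z, contDiffAt_id.mul hu_cd, by simp, ?_, ?_⟩
  · have := (hasFDerivAt_id (𝕜 := ℝ) (0 : ℂ)).mul
      (hu_cd.differentiableAt (by simp)).hasFDerivAt
    refine HasFDerivAt.congr_fderiv (f := fun z ↦ z * u z) this ?_
    ext z
    simp [hu0]
  · intro z
    simp only [hu, mul_pow, one_div, Complex.cpow_nat_inv_pow _ hk]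
    field_simp

theorem corollary1p1 (k : ℕ) (hk : 5 ≤ k)
    (h : MvPolynomial (Fin 2) ℝ) (hh_ne : h ≠ 0) (hh_hom : h.IsHomogeneous k)
    (hh_harm : ∀ x, Laplacian.laplacian (polyFun h) x = 0)
    (R : EuclideanSpace ℝ (Fin 2) → ℝ) (hR_smooth : IsSmoothGerm R) (hR_order : HasOrderGT R k)
    (hR_biharm : ∀ᶠ x in 𝓝 (0 : EuclideanSpace ℝ (Fin 2)),
      Laplacian.laplacian (Laplacian.laplacian R) x = 0) :
    RightEquivalent (polyFun h) (polyFun h + R) := by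
  have hk0 : k ≠ 0 := by lia
  let e : ℂ ≃ₗᵢ[ℝ] EuclideanSpace ℝ (Fin 2) := Complex.orthonormalBasisOneI.repr
  have he0 : Tendsto e (𝓝 0) (𝓝 0) := by simpa using e.continuous.tendsto 0
  have hes0 : Tendsto e.symm (𝓝 0) (𝓝 0) := by simpa using e.symm.continuous.tendsto 0
  obtain ⟨c, hc⟩ := exists_eq_re_const_mul_pow (h := polyFun h ∘ e) hk0
    (((contDiff_polyFun h).of_le le_top).comp e.contDiff)
    (by simp [laplacian_comp_linearIsometryEquiv, hh_harm])
    (fun t z ↦ by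
      rw [Function.comp_apply, Function.comp_apply, ← polyFun_smul hh_hom, ← map_smul,
        Complex.real_smul])
  have hc0 : c ≠ 0 := by
    rintro rfl
    refine hh_ne (MvPolynomial.funext fun x ↦ ?_)
    simpa [polyFun] using hc (e.symm (WithLp.toLp 2 x))
  obtain ⟨f, g, hf, hg, hRfg⟩ := exists_almansi_of_hasOrderGT (R := R ∘ e) (k := k) (by lia)
    ((he0.eventually hR_smooth.eventually_contDiffAt).mono fun z hz ↦ hz.comp z e.contDiff.contDiffAt)
    (fun j hj ↦ by
      rw [← norm_eq_zero, e.norm_iteratedFDeriv_comp_right, map_zero, hR_order j hj, norm_zero])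
    (by
      simp only [laplacian_comp_linearIsometryEquiv]
      exact he0.eventually hR_biharm)
  obtain ⟨Ψ, hΨ, hΨ0, hΨd, hΨk⟩ := exists_const_mul_pow_eq hk0 hc0
    (v := fun z ↦ z * f z + starRingEnd ℂ z * g z)
    ((contDiffAt_id.mul (hf.contDiffAt.restrict_scalars ℝ)).add
      (Complex.conjCLE.contDiff.contDiffAt.mul (hg.contDiffAt.restrict_scalars ℝ)))
    (by simp)
  obtain ⟨φ, hφ, hφΨ⟩ := exists_isDiffeoGerm_eq (Ψ := e ∘ Ψ ∘ e.symm)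
    (L := ContinuousLinearEquiv.refl ℝ _)
    (e.contDiff.contDiffAt.comp _
      (ContDiffAt.comp _ (by simpa using hΨ) e.symm.contDiff.contDiffAt))
    (by simp [hΨ0])
    (by
      have h1 : HasFDerivAt Ψ (ContinuousLinearMap.id ℝ ℂ) (e.symm 0) := by simpa using hΨd
      have h2 := (e.toContinuousLinearEquiv.hasFDerivAt (x := Ψ (e.symm 0))).comp 0
        (h1.comp 0 e.symm.toContinuousLinearEquiv.hasFDerivAt)
      refine h2.congr_fderiv ?_
      ext x : 1
      exact e.apply_symm_apply x)
  refine ⟨φ, hφ, ?_⟩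
  filter_upwards [hes0.eventually hRfg] with x hx
  have hh := hc (e.symm x)
  have hΨh := hc (Ψ (e.symm x))
  simp only [Function.comp_apply, e.apply_symm_apply] at hx hh hΨh
  rw [hφΨ, Pi.add_apply, hx, hh, Function.comp_apply, Function.comp_apply, Function.comp_apply, hΨh,
    hΨk, ← Complex.add_re]
  ring_nf
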